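/- For $\theta\in(0,1)$, $\boldsymbol\mu\in\mathbb R^d$ and a positive-definite symmetric $d\times d$ matrix $\boldsymbol\Sigma$, let $$f_{\mathrm{TIN}}(\boldsymbol x;\boldsymbol\mu,\boldsymbol\Sigma,\theta)=|\boldsymbol\Sigma|^{-1/2}\,g_\theta\big((\boldsymbol x-\boldsymbol\mu)'\boldsymbol\Sigma^{-1}(\boldsymbol x-\boldsymbol\mu)\big),\qquad g_\theta(t)=\frac{2\pi^{-d/2}}{\theta\,t^{d/2+1}}\Big[\Gamma\big(\tfrac d2+1,(1-\theta)\tfrac t2\big)-\Gamma\big(\tfrac d2+1,\tfrac t2\big)\Big]\quad(t>0),$$ where $\Gamma(\cdot,\cdot)$ is the upper incomplete gamma function and $g_\theta(0)=\lim_{t\downarrow0}g_\theta(t)=(2\pi)^{-d/2}\,\frac{1-(1-\theta)^{d/2+1}}{\theta\,(d/2+1)}$, be the density of the $d$-variate tail-inflated normal (MTIN) distribution with mean vector $\boldsymbol\mu$, scale matrix $\boldsymbol\Sigma$ and inflation parameter $\theta$. For a sample $\boldsymbol x_1,\dots,\boldsymbol x_n\in\mathbb R^d$ let $l(\boldsymbol\mu,\boldsymbol\Sigma,\theta)=\sum_{i=1}^n\log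 f_{\mathrm{TIN}}(\boldsymbol x_i;\boldsymbol\mu,\boldsymbol\Sigma,\theta)$ be the log-likelihood, and let $\mathcal M^+_{d\times d}$ be the set of positive-definite symmetric $d\times d$ matrices. Theorem 5. Fix $\theta\in(0,1)$ and let $n>d\left(\frac d2+1\right)$. For every sample $\boldsymbol x_1,\dots,\boldsymbol x_n\in\mathbb R^d$ that is not contained in a proper affine subspace of $\mathbb R^d$, there exists $(\widehat{\boldsymbol\mu},\widehat{\boldsymbol\Sigma})\in\mathbb R^d\times\mathcal M^+_{d\times d}$ such that $$l(\widehat{\boldsymbol\mu},\widehat{\boldsymbol\Sigma},\theta)\ge l(\boldsymbol\mu,\boldsymbol\Sigma,\theta)\qquad\text{for every }(\boldsymbol\mu,\boldsymbol\Sigma)\in\mathbb R^d\times\mathcal M^+_{d\times d}.$$ In particular, if $\boldsymbol x_1,\dots,\boldsymbol x_n$ is a random sample (independent observations) from an MTIN distribution with arbitrary parameters $\boldsymbol\mu_0\in\mathbb R^d$, $\boldsymbol\Sigma_0\in\mathcal M^+_{d\times d}$, $\theta_0\in(0,1)$, then such a maximizer $(\widehat{\boldsymbol\mu},\widehat{\boldsymbol\Sigma})$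 exists almost surely. -/

import Mathlib

open MeasureTheory

namespace MTIN

/-- The upper incomplete gamma function `Γ(s, x) = ∫ₓ^∞ u ^ (s - 1) e ^ (-u) du`. -/
noncomputable def upperGamma (s x : ℝ) : ℝ :=
  ∫ u in Set.Ioi x, u ^ (s - 1) * Real.exp (-u)

/-- The density generator `g` of the `d`-variate tail-inflated normal distribution. For `t > 0` it is
`2 π ^ (-d/2) / (θ t ^ (d/2 + 1)) * [Γ(d/2 + 1, (1 - θ) t / 2) - Γ(d/2 + 1, t / 2)]`.
At `t = 0`, where this expression reads `0 / 0`, it is given its limit as `t` decreases to `0`, namely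
`(2 π) ^ (-d/2) / θ * ∫ w in (1 - θ)..1, w ^ (d/2)`, written in closed form. -/
noncomputable def generator (d : ℕ) (θ t : ℝ) : ℝ :=
  if t = 0 then
    (2 * Real.pi) ^ (-((d : ℝ) / 2)) * (1 - (1 - θ) ^ ((d : ℝ) / 2 + 1)) /
      (θ * ((d : ℝ) / 2 + 1))
  else
    2 * Real.pi ^ (-((d : ℝ) / 2)) / (θ * t ^ ((d : ℝ) / 2 + 1)) *
      (upperGamma ((d : ℝ) / 2 + 1) ((1 - θ) * t / 2) - upperGamma ((d : ℝ) / 2 + 1) (t / 2))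

/-- The squared Mahalanobis distance `(x - μ)' S⁻¹ (x - μ)`. -/
noncomputable def mahalanobisSq {d : ℕ} (μ : Fin d → ℝ) (S : Matrix (Fin d) (Fin d) ℝ)
    (x : Fin d → ℝ) : ℝ :=
  (x - μ) ⬝ᵥ (S⁻¹.mulVec (x - μ))

/-- The probability density function of the tail-inflated normal distribution with mean vector `μ`,
scale matrix `S` and inflation parameter `θ`. -/
noncomputable def pdf {d : ℕ} (μ : Fin d → ℝ) (S : Matrix (Fin d) (Fin d) ℝ) (θ : ℝ)
    (x : Fin d → ℝ) : ℝ :=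
  S.det ^ (-(1 / 2 : ℝ)) * generator d θ (mahalanobisSq μ S x)

/-- The tail-inflated normal distribution, as a measure on `ℝ ^ d`. -/
noncomputable def law {d : ℕ} (μ : Fin d → ℝ) (S : Matrix (Fin d) (Fin d) ℝ) (θ : ℝ) :
    Measure (Fin d → ℝ) :=
  (volume : Measure (Fin d → ℝ)).withDensity (fun x => ENNReal.ofReal (pdf μ S θ x))

/-- The observed-data log-likelihood of `(μ, S, θ)` for the sample `x 0, …, x (n - 1)`. -/
noncomputable def logLik {d n : ℕ} (x : Fin n → Fin d → ℝ) (μ : Fin d → ℝ)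
    (S : Matrix (Fin d) (Fin d) ℝ) (θ : ℝ) : ℝ :=
  ∑ i, Real.log (pdf μ S θ (x i))

/-- For given `θ` and sample `x`, the log-likelihood attains its maximum over all mean vectors and
all positive-definite symmetric scale matrices. -/
def HasMLE {d n : ℕ} (x : Fin n → Fin d → ℝ) (θ : ℝ) : Prop :=
  ∃ (μhat : Fin d → ℝ) (Shat : Matrix (Fin d) (Fin d) ℝ), Shat.PosDef ∧
    ∀ (μ : Fin d → ℝ) (S : Matrix (Fin d) (Fin d) ℝ), S.PosDef →
      logLik x μ S θ ≤ logLik x μhat Shat θ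

end MTIN

/-! Writing `S⁻¹ = Bᵀ * B` and `b = B *ᵥ μ` turns the likelihood into a function of `(B, b)` on a
whole finite-dimensional vector space, with singular `B` allowed. There it is continuous
(`continuous_likelihood`) and vanishes at infinity (`tendsto_likelihood_cocompact`): the residuals
`B xᵢ - b` depend linearly and injectively on `(B, b)` when the sample spans, and Gaussian decay
beats the polynomial growth of the determinant. So a maximum exists; its value is positive, hence
`B` is invertible and gives back `(μ, S)`. The almost sure statement follows because the law has a
Lebesgue density, so `d + 1` independent observations are almost surely affinely independent. -/

namespace MTIN

open Matrix

/-! ### The generator as a Gaussian scale mixture -/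

/-- The density generator written as a scale mixture of Gaussian kernels. -/
noncomputable def mixture (d : ℕ) (θ t : ℝ) : ℝ :=
  (2 * Real.pi) ^ (-((d : ℝ) / 2)) / θ *
    ∫ w in (1 - θ)..1, w ^ ((d : ℝ) / 2) * Real.exp (-(w * t / 2))

theorem integrableOn_rpow_mul_exp_neg_Ioi {p a : ℝ} (hp : 0 ≤ p) (ha : 0 ≤ a) :
    IntegrableOn (fun u : ℝ => u ^ (p + 1 - 1) * Real.exp (-u)) (Set.Ioi a) := by
  have h := Real.GammaIntegral_convergent (s := p + 1) (by linarith)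
  exact (h.congr_fun (fun u _ => mul_comm _ _) measurableSet_Ioi).mono_set (Set.Ioi_subset_Ioi ha)

/-- Substitute `u = w * t / 2`. -/
theorem upperGamma_sub_upperGamma {p a t : ℝ} (hp : 0 ≤ p) (ha : 0 ≤ a) (ha1 : a ≤ 1)
    (ht : 0 < t) :
    upperGamma (p + 1) (a * t / 2) - upperGamma (p + 1) (t / 2) =
      (t / 2) ^ (p + 1) * ∫ w in a..1, w ^ p * Real.exp (-(w * t / 2)) := by
  have hat : 0 ≤ a * t / 2 := by positivity
  unfold upperGamma
  rw [intervalIntegral.integral_Ioi_sub_Ioi' (integrableOn_rpow_mul_exp_neg_Ioi hp hat)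
    (integrableOn_rpow_mul_exp_neg_Ioi hp (by positivity))]
  have h := intervalIntegral.smul_integral_comp_mul_left (a := a) (b := 1)
    (fun u : ℝ => u ^ (p + 1 - 1) * Real.exp (-u)) (t / 2)
  rw [mul_one, show t / 2 * a = a * t / 2 by ring] at h
  rw [← h, smul_eq_mul, ← intervalIntegral.integral_const_mul,
    ← intervalIntegral.integral_const_mul]
  refine intervalIntegral.integral_congr fun w hw => ?_
  rw [Set.uIcc_of_le ha1] at hw
  have hw0 : 0 ≤ w := ha.trans hw.1
  simp only [add_sub_cancel_right]
  rw [Real.mul_rpow (by positivity) hw0, Real.rpow_add_one (by positivity : t / 2 ≠ 0),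
    show t / 2 * w = w * t / 2 by ring]
  ring

theorem generator_eq_mixture (d : ℕ) {θ t : ℝ} (hθ : θ ∈ Set.Ioo (0 : ℝ) 1) (ht : 0 ≤ t) :
    generator d θ t = mixture d θ t := by
  obtain ⟨h0, h1⟩ := hθ
  have hp : (0 : ℝ) ≤ (d : ℝ) / 2 := by positivity
  unfold generator mixture
  split_ifs with h
  · subst h
    simp only [mul_zero, zero_div, neg_zero, Real.exp_zero, mul_one]
    rw [integral_rpow (Or.inl (by linarith)), Real.one_rpow]
    field_simp
  · have ht' : 0 < t := lt_of_le_of_ne ht (Ne.symm h)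
    rw [upperGamma_sub_upperGamma hp (by linarith) (by linarith) ht']
    have hpi := Real.pi_pos
    rw [Real.div_rpow ht zero_le_two, Real.mul_rpow zero_le_two hpi.le,
      Real.rpow_neg zero_le_two, Real.rpow_add_one (two_ne_zero : (2 : ℝ) ≠ 0)]
    have : t ^ ((d : ℝ) / 2 + 1) ≠ 0 := (Real.rpow_pos_of_pos ht' _).ne'
    have : (2 : ℝ) ^ ((d : ℝ) / 2) ≠ 0 := (Real.rpow_pos_of_pos two_pos _).ne'
    field_simp
    simp only [mul_comm t]

theorem continuous_mixture_integrand (d : ℕ) :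
    Continuous (Function.uncurry fun t w : ℝ =>
      w ^ ((d : ℝ) / 2) * Real.exp (-(w * t / 2))) := by
  refine Continuous.mul ?_ (by fun_prop)
  exact continuous_snd.rpow_const fun _ => Or.inr (by positivity)

theorem continuous_mixture (d : ℕ) (θ : ℝ) : Continuous (mixture d θ) := by
  unfold mixture
  exact continuous_const.mul
    (intervalIntegral.continuous_parametric_intervalIntegral_of_continuous'
      (continuous_mixture_integrand d) _ _)

theorem mixture_pos (d : ℕ) {θ : ℝ} (hθ : θ ∈ Set.Ioo (0 : ℝ) 1) (t : ℝ) :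
    0 < mixture d θ t := by
  obtain ⟨h0, h1⟩ := hθ
  have hpi := Real.pi_pos
  refine mul_pos (by positivity) ?_
  refine intervalIntegral.intervalIntegral_pos_of_pos_on ?_ (fun w hw => ?_) (by linarith)
  · exact ((continuous_mixture_integrand d).comp (Continuous.prodMk_right t)).intervalIntegrable _ _
  · have : 0 < w := by linarith [hw.1]
    positivity

/-- On `[1 - θ, 1]` the power is at most `1` and the exponential is largest at `w = 1 - θ`; the
interval length `θ` cancels the factor `1 / θ`. -/
theorem mixture_le (d : ℕ) {θ t : ℝ} (hθ : θ ∈ Set.Ioo (0 : ℝ) 1) (ht : 0 ≤ t) :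
    mixture d θ t ≤
      (2 * Real.pi) ^ (-((d : ℝ) / 2)) * Real.exp (-((1 - θ) / 2 * t)) := by
  obtain ⟨h0, h1⟩ := hθ
  have hpi := Real.pi_pos
  have h : ∫ w in (1 - θ)..1, w ^ ((d : ℝ) / 2) * Real.exp (-(w * t / 2)) ≤
      ∫ _ in (1 - θ)..1, Real.exp (-((1 - θ) / 2 * t)) := by
    refine intervalIntegral.integral_mono_on (by linarith) ?_ (by simp) fun w hw => ?_
    · exact ((continuous_mixture_integrand d).comp
        (Continuous.prodMk_right t)).intervalIntegrable _ _
    · have hw0 : 0 ≤ w := by linarith [hw.1]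
      have h2 : w ^ ((d : ℝ) / 2) ≤ 1 := Real.rpow_le_one hw0 hw.2 (by positivity)
      have h3 : Real.exp (-(w * t / 2)) ≤ Real.exp (-((1 - θ) / 2 * t)) := by
        rw [Real.exp_le_exp]
        nlinarith [mul_le_mul_of_nonneg_right hw.1 ht]
      calc _ ≤ 1 * Real.exp (-((1 - θ) / 2 * t)) := by gcongr
        _ = _ := one_mul _
  rw [intervalIntegral.integral_const, smul_eq_mul, sub_sub_cancel] at h
  calc mixture d θ t ≤ (2 * Real.pi) ^ (-((d : ℝ) / 2)) / θ *
        (θ * Real.exp (-((1 - θ) / 2 * t))) := by unfold mixture; gcongr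
    _ = _ := by field_simp

/-! ### Linear reparametrization of the likelihood -/

/-- The linear map sending `(B, b)` to the transformed sample `(B xᵢ - b)ᵢ`. -/
def residual {d n : ℕ} (x : Fin n → Fin d → ℝ) :
    (Matrix (Fin d) (Fin d) ℝ × (Fin d → ℝ)) →ₗ[ℝ] (Fin n → Fin d → ℝ) where
  toFun v i := v.1 *ᵥ x i - v.2
  map_add' v w := by
    ext1 i
    simp only [Prod.fst_add, Prod.snd_add, add_mulVec, Pi.add_apply]
    abel
  map_smul' c v := by
    ext1 i
    simp [smul_mulVec, smul_sub]

/-- A linear map equal to the constant `b` on an affinely spanning set is constant, and its value at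
`0` forces `b = 0`. -/
theorem residual_injective {d n : ℕ} {x : Fin n → Fin d → ℝ}
    (hx : affineSpan ℝ (Set.range x) = ⊤) : Function.Injective (residual x) := by
  rw [injective_iff_map_eq_zero]
  rintro ⟨B, b⟩ h
  have key : (Matrix.toLin' B).toAffineMap = AffineMap.const ℝ (Fin d → ℝ) b := by
    refine AffineMap.ext_on hx ?_
    rintro _ ⟨i, rfl⟩
    have := congrFun h i
    simpa [residual, sub_eq_zero] using this
  have hB : ∀ y, B *ᵥ y = b := fun y => by
    simpa using congrArg (fun f : (Fin d → ℝ) →ᵃ[ℝ] (Fin d → ℝ) => f y) key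
  have hb : b = 0 := by rw [← hB 0, mulVec_zero]
  have hB0 : B = 0 := by
    apply Matrix.toLin'.injective
    ext1 j
    ext k
    simp [hB, hb]
  rw [hb, hB0]
  rfl

/-- The likelihood in the parametrization `S⁻¹ = Bᵀ B`, `b = B μ`. -/
noncomputable def likelihood {d n : ℕ} (x : Fin n → Fin d → ℝ) (θ : ℝ)
    (v : Matrix (Fin d) (Fin d) ℝ × (Fin d → ℝ)) : ℝ :=
  ∏ i, (|v.1.det| * mixture d θ (residual x v i ⬝ᵥ residual x v i))

theorem pdf_eq {d : ℕ} {θ : ℝ} (hθ : θ ∈ Set.Ioo (0 : ℝ) 1)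
    {S B : Matrix (Fin d) (Fin d) ℝ} (hB : S⁻¹ = Bᵀ * B) (μ y : Fin d → ℝ) :
    pdf μ S θ y = |B.det| * mixture d θ ((B *ᵥ y - B *ᵥ μ) ⬝ᵥ (B *ᵥ y - B *ᵥ μ)) := by
  have h1 : mahalanobisSq μ S y = (B *ᵥ y - B *ᵥ μ) ⬝ᵥ (B *ᵥ y - B *ᵥ μ) := by
    unfold mahalanobisSq
    rw [hB, ← mulVec_sub, ← mulVec_mulVec, dotProduct_mulVec, vecMul_transpose]
  have h2 : S.det ^ (-(1 / 2 : ℝ)) = |B.det| := by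
    have h3 : S.det⁻¹ = B.det ^ 2 := by
      rw [← Ring.inverse_eq_inv', ← det_nonsing_inv, hB, det_mul, det_transpose, sq]
    have h4 : S.det = (B.det ^ 2)⁻¹ := by rw [← h3, inv_inv]
    rw [h4, Real.inv_rpow (sq_nonneg _), Real.rpow_neg (sq_nonneg _), inv_inv,
      ← Real.sqrt_eq_rpow, Real.sqrt_sq_eq_abs]
  rw [pdf, h1, h2, generator_eq_mixture d hθ]
  exact Finset.sum_nonneg fun i _ => mul_self_nonneg _

theorem logLik_eq {d n : ℕ} (x : Fin n → Fin d → ℝ) {θ : ℝ} (hθ : θ ∈ Set.Ioo (0 : ℝ) 1)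
    {S B : Matrix (Fin d) (Fin d) ℝ} (hB : S⁻¹ = Bᵀ * B) (hBdet : B.det ≠ 0)
    (μ : Fin d → ℝ) :
    logLik x μ S θ = Real.log (likelihood x θ (B, B *ᵥ μ)) := by
  unfold logLik likelihood
  rw [Real.log_prod]
  · refine Finset.sum_congr rfl fun i _ => ?_
    rw [pdf_eq hθ hB]
    rfl
  · intro i _
    exact (mul_pos (abs_pos.2 hBdet) (mixture_pos d hθ _)).ne'

theorem likelihood_pos {d n : ℕ} (x : Fin n → Fin d → ℝ) {θ : ℝ} (hθ : θ ∈ Set.Ioo (0 : ℝ) 1)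
    {v : Matrix (Fin d) (Fin d) ℝ × (Fin d → ℝ)} (hv : v.1.det ≠ 0) : 0 < likelihood x θ v :=
  Finset.prod_pos fun _ _ => mul_pos (abs_pos.2 hv) (mixture_pos d hθ _)

-- Decay of the likelihood at infinity

attribute [local instance] Matrix.normedAddCommGroup Matrix.normedSpace

theorem continuous_likelihood {d n : ℕ} (x : Fin n → Fin d → ℝ) (θ : ℝ) :
    Continuous (likelihood x θ) := by
  have h : Continuous (residual x) := (residual x).continuous_of_finiteDimensional
  refine continuous_finsetProd _ fun i _ => ?_
  have hi : Continuous fun v => residual x v i := (continuous_apply i).comp h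
  exact (continuous_fst.matrix_det.abs).mul
    ((continuous_mixture d θ).comp (hi.dotProduct hi))

theorem sq_norm_le_sum_dotProduct {d n : ℕ} (y : Fin n → Fin d → ℝ) :
    ‖y‖ ^ 2 ≤ ∑ i, y i ⬝ᵥ y i := by
  have hnn : 0 ≤ ∑ i, y i ⬝ᵥ y i :=
    Finset.sum_nonneg fun i _ => Finset.sum_nonneg fun j _ => mul_self_nonneg _
  rw [← Real.le_sqrt (norm_nonneg _) hnn, pi_norm_le_iff_of_nonneg (Real.sqrt_nonneg _)]
  intro i
  rw [pi_norm_le_iff_of_nonneg (Real.sqrt_nonneg _)]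
  intro j
  rw [Real.norm_eq_abs]
  apply Real.abs_le_sqrt
  calc y i j ^ 2 = y i j * y i j := sq _
    _ ≤ y i ⬝ᵥ y i :=
      Finset.single_le_sum (f := fun j => y i j * y i j) (fun j _ => mul_self_nonneg _)
        (Finset.mem_univ j)
    _ ≤ _ := Finset.single_le_sum (f := fun i => y i ⬝ᵥ y i)
        (fun i _ => Finset.sum_nonneg fun j _ => mul_self_nonneg _) (Finset.mem_univ i)

theorem abs_det_le {d : ℕ} (B : Matrix (Fin d) (Fin d) ℝ) :
    |B.det| ≤ d.factorial * ‖B‖ ^ d := by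
  have h := Matrix.det_le (A := B) (abv := AbsoluteValue.abs) (x := ‖B‖)
    fun i j => Matrix.norm_entry_le_entrywise_sup_norm B
  simpa using h

/-- An injective linear map in finite dimension is antilipschitz, so the residuals grow at least
like `‖v‖ / K`. Each of the `n` determinants contributes degree `d`. -/
theorem likelihood_le {d n : ℕ} {x : Fin n → Fin d → ℝ} {θ : ℝ} (hθ : θ ∈ Set.Ioo (0 : ℝ) 1)
    (hx : affineSpan ℝ (Set.range x) = ⊤) :
    ∃ C c : ℝ, 0 < c ∧ ∀ v, likelihood x θ v ≤
      C * (‖v‖ ^ ((d * n : ℕ) : ℝ) * Real.exp (-c * ‖v‖ ^ 2)) := by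
  obtain ⟨K, hK, hanti⟩ := (residual x).exists_antilipschitzWith
    (LinearMap.ker_eq_bot.2 (residual_injective hx))
  have hpi := Real.pi_pos
  set C₀ : ℝ := (2 * Real.pi) ^ (-((d : ℝ) / 2)) with hC₀
  have hC₀' : 0 < C₀ := by positivity
  have hK' : (0 : ℝ) < K := hK
  have hθ' : 0 < (1 - θ) / 2 := by linarith [hθ.2]
  refine ⟨(d.factorial * C₀) ^ n, (1 - θ) / 2 / K ^ 2, by positivity, fun v => ?_⟩
  have hnorm : ‖v‖ ^ 2 / K ^ 2 ≤ ∑ i, residual x v i ⬝ᵥ residual x v i := by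
    refine le_trans ?_ (sq_norm_le_sum_dotProduct _)
    have h := hanti.le_mul_dist v 0
    rw [map_zero, dist_zero_right, dist_zero_right] at h
    rw [← div_pow]
    gcongr
    rwa [div_le_iff₀' hK']
  have hdet : |v.1.det| ≤ d.factorial * ‖v‖ ^ d :=
    (abs_det_le v.1).trans (by gcongr; exact norm_fst_le v)
  calc likelihood x θ v
      ≤ ∏ i, ((d.factorial * ‖v‖ ^ d) * (C₀ *
          Real.exp (-((1 - θ) / 2 * (residual x v i ⬝ᵥ residual x v i))))) := by
        refine Finset.prod_le_prod (fun i _ => ?_) fun i _ => ?_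
        · exact mul_nonneg (abs_nonneg _) (mixture_pos d hθ _).le
        · exact mul_le_mul hdet
            (mixture_le d hθ (Finset.sum_nonneg fun j _ => mul_self_nonneg _))
            (mixture_pos d hθ _).le (by positivity)
    _ = (d.factorial * C₀) ^ n * (‖v‖ ^ ((d * n : ℕ) : ℝ) *
          Real.exp (-((1 - θ) / 2 * ∑ i, residual x v i ⬝ᵥ residual x v i))) := by
        rw [Finset.prod_mul_distrib, Finset.prod_mul_distrib (f := fun _ => C₀), ← Real.exp_sum,
          Finset.sum_neg_distrib, ← Finset.mul_sum, Real.rpow_natCast]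
        simp only [Finset.prod_const, Finset.card_univ, Fintype.card_fin]
        rw [mul_pow, mul_pow, pow_mul]
        ring
    _ ≤ _ := by
        gcongr
        rw [neg_mul, neg_le_neg_iff, div_mul_eq_mul_div, mul_div_assoc]
        gcongr

theorem tendsto_likelihood_cocompact {d n : ℕ} {x : Fin n → Fin d → ℝ} {θ : ℝ}
    (hθ : θ ∈ Set.Ioo (0 : ℝ) 1) (hx : affineSpan ℝ (Set.range x) = ⊤) :
    Filter.Tendsto (likelihood x θ) (Filter.cocompact _) (nhds 0) := by
  obtain ⟨C, c, hc, hle⟩ := likelihood_le hθ hx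
  have h1 : Filter.Tendsto (fun r : ℝ => Real.exp (-(1 / 2) * r)) Filter.atTop (nhds 0) :=
    Real.tendsto_exp_atBot.comp (Filter.tendsto_id.const_mul_atTop_of_neg (by norm_num))
  have h2 := (rpow_mul_exp_neg_mul_sq_isLittleO_exp_neg hc ((d * n : ℕ) : ℝ)).trans_tendsto h1
  have h3 := ((h2.const_mul C).comp
    (tendsto_norm_cocompact_atTop (E := Matrix (Fin d) (Fin d) ℝ × (Fin d → ℝ))))
  rw [mul_zero] at h3
  refine squeeze_zero (fun v => ?_) hle h3
  exact Finset.prod_nonneg fun i _ => mul_nonneg (abs_nonneg _) (mixture_pos d hθ _).le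

/-! ### Existence of the maximizer -/

theorem exists_transpose_mul_self_eq_inv {d : ℕ} {S : Matrix (Fin d) (Fin d) ℝ} (hS : S.PosDef) :
    ∃ B : Matrix (Fin d) (Fin d) ℝ, S⁻¹ = Bᵀ * B ∧ B.det ≠ 0 := by
  open scoped MatrixOrder in
  obtain ⟨B, hB⟩ := CStarAlgebra.nonneg_iff_eq_star_mul_self.mp hS.inv.posSemidef.nonneg
  rw [star_eq_conjTranspose, conjTranspose_eq_transpose_of_trivial] at hB
  refine ⟨B, hB, fun h => hS.inv.det_pos.ne' ?_⟩
  rw [hB, det_mul, h, mul_zero]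

theorem hasMLE_of_affineSpan_eq_top {d n : ℕ} (hn : n ≠ 0) {x : Fin n → Fin d → ℝ} {θ : ℝ}
    (hθ : θ ∈ Set.Ioo (0 : ℝ) 1) (hx : affineSpan ℝ (Set.range x) = ⊤) : HasMLE x θ := by
  have h1 : 0 < likelihood x θ (1, 0) := likelihood_pos x hθ (by simp)
  obtain ⟨⟨B, b⟩, hmax⟩ := (continuous_likelihood x θ).exists_forall_ge' (1, 0)
    (((tendsto_likelihood_cocompact hθ hx).eventually_lt_const h1).mono fun _ h => h.le)
  -- A singular `B` gives likelihood `0`, below the value at `(1, 0)`; `n ≠ 0` rules out the empty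
  -- product `1`.
  have hdet : B.det ≠ 0 := by
    intro h
    have h2 := h1.trans_le (hmax (1, 0))
    simp [likelihood, h, hn] at h2
  have hunit : IsUnit B.det := hdet.isUnit
  have hA : (Bᵀ * B).PosDef := by
    have := PosDef.conjTranspose_mul_self B
      (mulVec_injective_of_isUnit ((isUnit_iff_isUnit_det B).2 hunit))
    rwa [conjTranspose_eq_transpose_of_trivial] at this
  refine ⟨B⁻¹ *ᵥ b, (Bᵀ * B)⁻¹, hA.inv, fun μ S hS => ?_⟩
  obtain ⟨B', hB', hdet'⟩ := exists_transpose_mul_self_eq_inv hS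
  rw [logLik_eq x hθ hB' hdet', logLik_eq x hθ (B := B)
    (nonsing_inv_nonsing_inv _ hA.det_pos.ne'.isUnit) hdet,
    mulVec_mulVec, mul_nonsing_inv _ hunit, one_mulVec]
  exact Real.log_le_log (likelihood_pos x hθ hdet') (hmax _)

end MTIN

/-! ### Random samples affinely span almost surely -/

section AffineSpan

variable {E : Type*} [NormedAddCommGroup E] [NormedSpace ℝ E] [FiniteDimensional ℝ E]

theorem affineIndependent_fin_cons {V : Type*} [AddCommGroup V] [Module ℝ V] {n : ℕ}
    {y : V} {x : Fin n → V} (hx : AffineIndependent ℝ x)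
    (hy : y ∉ affineSpan ℝ (Set.range x)) :
    AffineIndependent ℝ (Fin.cons y x : Fin (n + 1) → V) := by
  refine AffineIndependent.affineIndependent_of_notMem_span (i := 0) ?_ ?_
  · rw [← affineIndependent_equiv (finSuccAboveEquiv (0 : Fin (n + 1)))]
    have : (fun j : {j : Fin (n + 1) // j ≠ 0} => (Fin.cons y x : Fin (n + 1) → V) j) ∘
        finSuccAboveEquiv (0 : Fin (n + 1)) = x := by
      ext j
      simp [finSuccAboveEquiv_apply]
    rwa [this]
  · have : (Fin.cons y x : Fin (n + 1) → V) '' {j | j ≠ 0} = Set.range x := by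
      ext z
      constructor
      · rintro ⟨j, hj, rfl⟩
        obtain ⟨k, rfl⟩ := Fin.exists_succ_eq.2 hj
        exact ⟨k, rfl⟩
      · rintro ⟨k, rfl⟩
        exact ⟨k.succ, Fin.succ_ne_zero k, rfl⟩
    rwa [this]

variable [MeasurableSpace E] [BorelSpace E]

/-- At most `finrank` points span a proper affine subspace, which is null, so by Fubini one further
independent point almost surely avoids it. -/
theorem ae_affineIndependent_pi {ν m : Measure E} [SigmaFinite ν] [m.IsAddHaarMeasure]
    (hν : ν ≪ m) (n : ℕ) (hn : n ≤ Module.finrank ℝ E + 1) :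
    ∀ᵐ x ∂(Measure.pi fun _ : Fin n => ν), AffineIndependent ℝ x := by
  induction n with
  | zero => exact ae_of_all _ fun x => affineIndependent_of_subsingleton ℝ x
  | succ n ih =>
    have hmp := measurePreserving_piFinSuccAbove (fun _ : Fin (n + 1) => ν) 0
    have hcons : Continuous fun z : E × (Fin n → E) => (Fin.cons z.1 z.2 : Fin (n + 1) → E) :=
      Continuous.finCons (A := fun _ => E) continuous_fst continuous_snd
    have hmeas : MeasurableSet {z : E × (Fin n → E) |
        AffineIndependent ℝ (Fin.cons z.1 z.2 : Fin (n + 1) → E)} :=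
      (isOpen_setOfPred_affineIndependent.preimage hcons).measurableSet
    have key : ∀ᵐ z ∂(ν.prod (Measure.pi fun _ : Fin n => ν)),
        AffineIndependent ℝ (Fin.cons z.1 z.2 : Fin (n + 1) → E) := by
      -- The quantifiers are swapped so that the earlier points `x` are fixed while the new point
      -- `y` varies.
      rw [Measure.ae_prod_iff_ae_ae hmeas,
        Measure.ae_ae_comm (p := fun y x => AffineIndependent ℝ (Fin.cons y x : Fin (n + 1) → E))
          hmeas]
      filter_upwards [ih (by omega)] with x hx
      have hne : affineSpan ℝ (Set.range x) ≠ ⊤ := fun h => by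
        have := hx.affineSpan_eq_top_iff_card_eq_finrank_add_one.1 h
        rw [Fintype.card_fin] at this
        omega
      have hnull := hν (Measure.addHaar_affineSubspace m _ hne)
      filter_upwards [measure_eq_zero_iff_ae_notMem.1 hnull] with y hy
      exact affineIndependent_fin_cons hx hy
    filter_upwards [hmp.quasiMeasurePreserving.ae key] with x hx
    convert hx
    exact (Fin.cons_self_tail x).symm

/-- Points beyond the first `finrank + 1` can only enlarge the span. -/
theorem ae_affineSpan_range_eq_top {ν m : Measure E} [SigmaFinite ν] [m.IsAddHaarMeasure]
    (hν : ν ≪ m) {n : ℕ} (hn : Module.finrank ℝ E + 1 ≤ n) :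
    ∀ᵐ x ∂(Measure.pi fun _ : Fin n => ν), affineSpan ℝ (Set.range x) = ⊤ := by
  induction n, hn using Nat.le_induction with
  | base =>
    filter_upwards [ae_affineIndependent_pi hν _ le_rfl] with x hx
    exact hx.affineSpan_eq_top_iff_card_eq_finrank_add_one.2 (Fintype.card_fin _)
  | succ n _ ih =>
    have hmp := measurePreserving_piFinSuccAbove (fun _ : Fin (n + 1) => ν) 0
    have hq := Measure.quasiMeasurePreserving_snd.comp hmp.quasiMeasurePreserving
    filter_upwards [hq.ae ih] with x hx
    rw [eq_top_iff, ← hx]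
    refine affineSpan_mono ℝ ?_
    rintro _ ⟨i, rfl⟩
    exact ⟨i.succ, rfl⟩

end AffineSpan

theorem theorem5 (d n : ℕ) (θ : ℝ) (hθ : θ ∈ Set.Ioo (0 : ℝ) 1)
    (hn : (d : ℝ) * ((d : ℝ) / 2 + 1) < (n : ℝ)) :
    -- every sample that does not lie in a proper affine subspace
    (∀ x : Fin n → Fin d → ℝ, affineSpan ℝ (Set.range x) = ⊤ → MTIN.HasMLE x θ) ∧
    -- almost every random sample from a tail-inflated normal distribution
    (∀ (μ₀ : Fin d → ℝ) (S₀ : Matrix (Fin d) (Fin d) ℝ) (θ₀ : ℝ), S₀.PosDef →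
      θ₀ ∈ Set.Ioo (0 : ℝ) 1 →
      ∀ᵐ x ∂(MeasureTheory.Measure.pi fun _ : Fin n => MTIN.law μ₀ S₀ θ₀), MTIN.HasMLE x θ) := by
  -- Since `d / 2 + 1 ≥ 1`, the bound on `n` gives `n > d`, also when `d = 0`.
  have hdn : d + 1 ≤ n := by
    by_contra! h
    have h1 : (n : ℝ) ≤ d := by exact_mod_cast Nat.lt_succ_iff.1 h
    rcases Nat.eq_zero_or_pos d with rfl | hd
    · simp at hn h1
      linarith
    · nlinarith [sq_nonneg (d : ℝ)]
  have main : ∀ x : Fin n → Fin d → ℝ, affineSpan ℝ (Set.range x) = ⊤ → MTIN.HasMLE x θ :=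
    fun x hx => MTIN.hasMLE_of_affineSpan_eq_top (by omega) hθ hx
  refine ⟨main, fun μ₀ S₀ θ₀ _ _ => ?_⟩
  have hσ : SigmaFinite (MTIN.law μ₀ S₀ θ₀) :=
    SigmaFinite.withDensity_of_ne_top' fun _ => ENNReal.ofReal_ne_top
  have hac : MTIN.law μ₀ S₀ θ₀ ≪ (volume : Measure (Fin d → ℝ)) :=
    withDensity_absolutelyContinuous _ _
  exact (ae_affineSpan_range_eq_top hac (by simpa using hdn)).mono main
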